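/- Let $n,T$ be nonnegative integers, and let $L_t:\mathbb R^n\times\mathbb R^n\to\mathbb R\cup\{+\infty\}$ ($1\le t\le T$) and $g:\mathbb R^n\to\mathbb R\cup\{+\infty\}$ be proper, convex and lower semicontinuous (l.s.c.). Write $\varphi^*(y)=\sup_{x\in\mathbb R^n}\{x\cdot y-\varphi(x)\}$ for the conjugate of $\varphi:\mathbb R^n\to\mathbb R\cup\{\pm\infty\}$, $\operatorname{dom}\varphi=\{\varphi<+\infty\}$, $\Delta x_t=x_t-x_{t-1}$, and $\operatorname{ri}$ for the relative interior. Put $$K_t(p,w)=\sup_{x,v\in\mathbb R^n}\{x\cdot w+v\cdot p-L_t(x,v)\},\qquad f(b)=g^*(-b),$$ and, for $0\le\tau\le T$ and $\xi,\eta\in\mathbb R^n$, $$\vartheta_\tau(\xi)=\inf\Big\{\sum_{t=\tau+1}^T L_t(x_{t-1},\Delta x_t)+g(x_T)\;\Big|\;\{x_t\}_{t=\tau}^T\subset\mathbb R^n,\ x_\tau=\xi\Big\},$$ $$\omega_\tau(\eta)=\inf\Big\{\sum_{t=\tau+1}^T K_t(p_t,\Delta p_t)+f(p_T)\;\Big|\;\{p_t\}_{t=\tau}^T\subset\mathbb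 R^n,\ p_\tau=-\eta\Big\},$$ so that $\vartheta_T=g$ and $\omega_T(\eta)=f(-\eta)$. Let $$\Gamma_L(t,x)=\{v: L_t(x,v)\in\mathbb R\},\quad \mathbf X(t)=\{x:\Gamma_L(t,x)\ne\emptyset\},$$ $$\Gamma_K(t,p)=\{w: K_t(p+w,w)\in\mathbb R\},\quad \mathbf P(t)=\{p:\Gamma_K(t,p)\ne\emptyset\},$$ and consider the conditions (H) there is $\{\bar x_t\}_{t=0}^T\subset\mathbb R^n$ with $\bar x_T\in\operatorname{ri}(\operatorname{dom} g)$ and, for all $1\le t\le T$, $\bar x_{t-1}\in\operatorname{ri}(\mathbf X(t))$ and $\Delta\bar x_t\in\operatorname{ri}(\Gamma_L(t,\bar x_{t-1}))$; (H') there is $\{\bar p_t\}_{t=0}^T\subset\mathbb R^n$ with $\bar p_T\in\operatorname{ri}(\operatorname{dom} f)$ and, for all $1\le t\le T$, $\bar p_{t-1}\in\operatorname{ri}(\mathbf P(t))$ and $\Delta\bar p_t\in\operatorname{ri}(\Gamma_K(t,\bar p_{t-1}))$. Suppose (H') holds. Then for every $0\le\tau\le T$ one has $\omega_\tau^*=\vartheta_\tau$,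 and the infimum defining $\vartheta_\tau(\xi)$ is attained for every $\xi\in\operatorname{dom}\vartheta_\tau$. If in addition (H) holds, then for every $0\le\tau\le T$ the functions $\vartheta_\tau$ and $\omega_\tau$ are proper, convex and l.s.c., and they are conjugate to each other: $\vartheta_\tau^*=\omega_\tau$ and $\omega_\tau^*=\vartheta_\tau$. -/

import Mathlib

noncomputable section

namespace ConvexBolza

/-- `ℝⁿ` with the Euclidean norm and inner product. -/
abbrev Vec (n : ℕ) := EuclideanSpace ℝ (Fin n)

/-- The effective domain of an extended-real-valued function. -/
def dom {X : Type*} (φ : X → EReal) : Set X := {x | φ x < ⊤}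

/-- The epigraph of an extended-real-valued function, a subset of `X × ℝ`. -/
def epi {X : Type*} (φ : X → EReal) : Set (X × ℝ) := {q | φ q.1 ≤ (q.2 : EReal)}

/-- Proper: nonempty effective domain and nowhere `-∞`. -/
def IsProper {X : Type*} (φ : X → EReal) : Prop :=
  (dom φ).Nonempty ∧ ∀ x, ⊥ < φ x

/-- Proper, convex (convex epigraph) and lower semicontinuous. -/
structure IsProperConvexLsc {X : Type*} [AddCommGroup X] [Module ℝ X] [TopologicalSpace X]
    (φ : X → EReal) : Prop where
  proper : IsProper φ
  convex : Convex ℝ (epi φ)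
  lsc : LowerSemicontinuous φ

/-- The (Legendre-Fenchel) conjugate with respect to the Euclidean inner product. -/
def conj {n : ℕ} (φ : Vec n → EReal) (y : Vec n) : EReal :=
  ⨆ x : Vec n, ((inner ℝ x y : ℝ) : EReal) - φ x

variable {n : ℕ}

/-- The dual Lagrangian `K_t(p, w) = sup_{x, v} (x ⬝ w + v ⬝ p - L_t(x, v))`. -/
def dualLagrangian (L : ℕ → Vec n × Vec n → EReal) (t : ℕ) (q : Vec n × Vec n) : EReal :=
  ⨆ z : Vec n × Vec n, ((inner ℝ z.1 q.2 + inner ℝ z.2 q.1 : ℝ) : EReal) - L t z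

/-- The dual terminal cost `f(b) = g^*(-b)`. -/
def dualTerminal (g : Vec n → EReal) (b : Vec n) : EReal := conj g (-b)

/-- Cost of the process `x_τ, …, x_T` in the primal problem; only these values of `x` matter. -/
def primalCost (L : ℕ → Vec n × Vec n → EReal) (g : Vec n → EReal) (T τ : ℕ)
    (x : ℕ → Vec n) : EReal :=
  (∑ t ∈ Finset.Ioc τ T, L t (x (t - 1), x t - x (t - 1))) + g (x T)

/-- The primal value function. -/
def primalValue (L : ℕ → Vec n × Vec n → EReal) (g : Vec n → EReal) (T τ : ℕ)
    (ξ : Vec n) : EReal :=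
  ⨅ x : {x : ℕ → Vec n // x τ = ξ}, primalCost L g T τ x.1

/-- Cost of the process `p_τ, …, p_T` in the dual problem; only these values of `p` matter. -/
def dualCost (L : ℕ → Vec n × Vec n → EReal) (g : Vec n → EReal) (T τ : ℕ)
    (p : ℕ → Vec n) : EReal :=
  (∑ t ∈ Finset.Ioc τ T, dualLagrangian L t (p t, p t - p (t - 1))) + dualTerminal g (p T)

/-- The dual value function. -/
def dualValue (L : ℕ → Vec n × Vec n → EReal) (g : Vec n → EReal) (T τ : ℕ)
    (η : Vec n) : EReal :=
  ⨅ p : {p : ℕ → Vec n // p τ = -η}, dualCost L g T τ p.1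

/-- `Γ_L(t, x)`: the velocities `v` for which `L_t(x, v)` is a real number. -/
def primalVelocities (L : ℕ → Vec n × Vec n → EReal) (t : ℕ) (x : Vec n) : Set (Vec n) :=
  {v | ∃ r : ℝ, L t (x, v) = (r : EReal)}

/-- The states `x` with `Γ_L(t, x) ≠ ∅`. -/
def primalStates (L : ℕ → Vec n × Vec n → EReal) (t : ℕ) : Set (Vec n) :=
  {x | (primalVelocities L t x).Nonempty}

/-- `Γ_K(t, p)`: the velocities `w` for which `K_t(p + w, w)` is a real number. -/
def dualVelocities (L : ℕ → Vec n × Vec n → EReal) (t : ℕ) (p : Vec n) : Set (Vec n) :=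
  {w | ∃ r : ℝ, dualLagrangian L t (p + w, w) = (r : EReal)}

/-- The dual states `p` with `Γ_K(t, p) ≠ ∅`. -/
def dualStates (L : ℕ → Vec n × Vec n → EReal) (t : ℕ) : Set (Vec n) :=
  {p | (dualVelocities L t p).Nonempty}

/-- Strict feasibility of the primal system. -/
def PrimalStrictlyFeasible (L : ℕ → Vec n × Vec n → EReal) (g : Vec n → EReal) (T : ℕ) : Prop :=
  ∃ x : ℕ → Vec n, x T ∈ intrinsicInterior ℝ (dom g) ∧
    ∀ t ∈ Finset.Icc 1 T, x (t - 1) ∈ intrinsicInterior ℝ (primalStates L t) ∧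
      x t - x (t - 1) ∈ intrinsicInterior ℝ (primalVelocities L t (x (t - 1)))

/-- Strict feasibility of the dual system. -/
def DualStrictlyFeasible (L : ℕ → Vec n × Vec n → EReal) (g : Vec n → EReal) (T : ℕ) : Prop :=
  ∃ p : ℕ → Vec n, p T ∈ intrinsicInterior ℝ (dom (dualTerminal g)) ∧
    ∀ t ∈ Finset.Icc 1 T, p (t - 1) ∈ intrinsicInterior ℝ (dualStates L t) ∧
      p t - p (t - 1) ∈ intrinsicInterior ℝ (dualVelocities L t (p (t - 1)))

end ConvexBolza

end

/-! Weak duality is a discrete integration by parts: $x_{t-1}\cdot\Delta p_t+\Delta x_t\cdot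
p_t=x_t\cdot p_t-x_{t-1}\cdot p_{t-1}$, so summing the Fenchel-Young inequalities along two paths
leaves only the boundary term at $\tau$ (`neg_inner_le_primalCost_add_dualCost`). This bounds the
conjugate of each value function by the other one.

The reverse bounds come from `exists_dual_path`, an abstract duality theorem for convex costs
depending on the endpoints of each step. If a linear function of $x_\tau$ is dominated by the cost
plus a constant, and some path lies in the relative core of every domain, then there are multipliers
$y_t$ for which the sum of the conjugates of the step costs at $(y_{t-1},-y_t)$ and of the terminal
cost at $y_T$ is at most that constant. The proof is dynamic programming, with one application of
Fenchel duality (`exists_linearMap_split`) per step.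

Applied to the dual problem under (H'), the multipliers are, up to sign, a primal path;
biconjugation of $L_t$ and $g$ (`exists_affine_minorant`) identifies the bound with its primal cost
and gives attainment. Applied to the primal problem under (H), it gives
$\vartheta_\tau^*=\omega_\tau$ without biconjugation, since $K_t$ and $f$ are conjugates by
definition. Each value function is then a conjugate, hence convex and l.s.c.

Interiors enter only through the algebraic `relCore`, which makes sense on the space of all paths
and needs no topology there. -/

open Filter Topology

namespace ConvexBolza

/-! ### Relative algebraic interiors and Fenchel duality. -/

section Core

variable {V W : Type*} [AddCommGroup V] [Module ℝ V] [AddCommGroup W] [Module ℝ W]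

/-- The relative algebraic interior of a set: every segment of the set that ends at the point can
be prolonged beyond it inside the set. -/
def relCore (C : Set V) : Set V :=
  {z | z ∈ C ∧ ∀ z' ∈ C, ∃ ε : ℝ, 0 < ε ∧ z + ε • (z - z') ∈ C}

/-- By convexity every shorter prolongation works too. The "eventually" form lets finitely many
constraints share one $\varepsilon$. -/
theorem eventually_add_smul_sub_mem {C : Set V} (hC : Convex ℝ C) {z z' : V}
    (hz : z ∈ relCore C) (hz' : z' ∈ C) : ∀ᶠ ε : ℝ in 𝓝[>] 0, z + ε • (z - z') ∈ C := by
  obtain ⟨ε, hε, h⟩ := hz.2 z' hz'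
  filter_upwards [Ioc_mem_nhdsGT hε] with δ hδ
  have := hC hz.1 h (a := 1 - δ / ε) (b := δ / ε)
    (by rw [sub_nonneg, div_le_one hε]; exact hδ.2) (by have := hδ.1; positivity) (by ring)
  convert this using 1
  have h1 : δ = δ / ε * ε := by field_simp
  conv_lhs => rw [h1]
  module

/-- The line through the two points stays in the affine span, where the point is interior in the
topological sense. -/
theorem intrinsicInterior_subset_relCore {E : Type*} [NormedAddCommGroup E] [NormedSpace ℝ E]
    (C : Set E) : intrinsicInterior ℝ C ⊆ relCore C := by
  intro z hz
  refine ⟨intrinsicInterior_subset hz, fun z' hz' => ?_⟩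
  obtain ⟨y, hy, rfl⟩ := mem_intrinsicInterior.1 hz
  have hmem : ∀ δ : ℝ, AffineMap.lineMap (y : E) z' δ ∈ affineSpan ℝ C := fun δ =>
    AffineMap.lineMap_mem δ y.2 (subset_affineSpan ℝ C hz')
  let γ : ℝ → affineSpan ℝ C := fun δ => ⟨AffineMap.lineMap (y : E) z' (-δ), hmem _⟩
  have hγ : Continuous γ := by
    refine Continuous.subtype_mk ?_ _
    simp only [AffineMap.lineMap_apply]
    fun_prop
  have h0 : γ 0 = y := by
    apply Subtype.ext
    simp [γ]
  have hev : ∀ᶠ δ in 𝓝 (0 : ℝ), γ δ ∈ interior ((↑) ⁻¹' C : Set (affineSpan ℝ C)) :=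
    hγ.continuousAt.eventually_mem (by rw [h0]; exact isOpen_interior.mem_nhds hy)
  obtain ⟨ε, hε, h⟩ := Metric.eventually_nhds_iff.1 hev
  have hγε := interior_subset (h (y := ε / 2) (by simp [abs_of_pos hε, hε]))
  refine ⟨ε / 2, by positivity, ?_⟩
  have : (γ (ε / 2) : E) = y + (ε / 2) • ((y : E) - z') := by
    simp only [γ, AffineMap.lineMap_apply, vsub_eq_sub, vadd_eq_add]
    module
  rw [← this]
  exact hγε

/-- To prolong away from $(a,b)$, pick $b'$ over the point prolonged beyond $x$ and mix it with $b$
to land over $x$. Prolong from that point through $y$ inside the section, then mix with $b'$ again;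
the weights are those for which $b'$ cancels. -/
theorem mem_relCore_of_sections {B : Set (V × W)} (hB : Convex ℝ B) {x : V} {y : W}
    (hx : x ∈ relCore {a | {b | (a, b) ∈ B}.Nonempty}) (hy : y ∈ relCore {b | (x, b) ∈ B}) :
    (x, y) ∈ relCore B := by
  refine ⟨hy.1, ?_⟩
  rintro ⟨a, b⟩ hab
  obtain ⟨ε, hε, b', hb'⟩ := hx.2 a ⟨b, hab⟩
  have h1 : (x, (ε / (1 + ε)) • b + (1 / (1 + ε)) • b') ∈ B := by
    have := hB hab hb' (a := ε / (1 + ε)) (b := 1 / (1 + ε)) (by positivity) (by positivity)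
      (by field_simp; ring)
    convert this using 1
    ext1
    · simp only [Prod.fst_add, Prod.smul_fst]
      match_scalars
      · field_simp
      · ring
    · simp
  obtain ⟨δ, hδ, h2⟩ := hy.2 _ h1
  refine ⟨δ * ε / (1 + ε + δ), by positivity, ?_⟩
  have := hB hb' h2 (a := δ / (1 + ε + δ)) (b := (1 + ε) / (1 + ε + δ)) (by positivity)
    (by positivity) (by field_simp; ring)
  convert this using 1
  ext1
  · simp only [Prod.fst_add, Prod.smul_fst, Prod.fst_sub]
    match_scalars <;> field_simp
    ring
  · simp only [Prod.snd_add, Prod.smul_snd, Prod.snd_sub]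
    match_scalars <;> field_simp <;> ring

/-- A convex set in `V × ℝ` that projects to a set with `0` in its relative algebraic interior and
meets the vertical line over `0` in nonnegative heights only lies above a linear functional. -/
theorem exists_linearMap_le {Q : Set (V × ℝ)} (hQ : Convex ℝ Q)
    (h0 : ∀ t, ((0 : V), t) ∈ Q → 0 ≤ t) (hcore : (0 : V) ∈ relCore (Prod.fst '' Q)) :
    ∃ m : V →ₗ[ℝ] ℝ, ∀ q ∈ Q, m q.1 ≤ q.2 := by
  obtain ⟨⟨q₀, hq₀, hq₀0⟩, hcore⟩ := hcore
  have hdom : Convex ℝ (Prod.fst '' Q) := hQ.linear_image (LinearMap.fst ℝ V ℝ)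
  let s : PointedCone ℝ (V × ℝ) :=
    { carrier := {x | ∃ c : ℝ, 0 ≤ c ∧ ∃ q ∈ Q, x = c • q}
      zero_mem' := ⟨0, le_rfl, q₀, hq₀, by simp⟩
      smul_mem' := by
        rintro ⟨a, ha⟩ _ ⟨c, hc, q, hq, rfl⟩
        exact ⟨a * c, mul_nonneg ha hc, q, hq, by rw [mul_smul]; rfl⟩
      add_mem' := by
        rintro _ _ ⟨c, hc, q, hq, rfl⟩ ⟨c', hc', q', hq', rfl⟩
        rcases (add_nonneg hc hc').eq_or_lt with h | h
        · have h1 : c = 0 := by linarith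
          have h2 : c' = 0 := by linarith
          exact ⟨0, le_rfl, q, hq, by simp [h1, h2]⟩
        · refine ⟨c + c', h.le, _, convex_iff_div.1 hQ hq hq' hc hc' h, ?_⟩
          rw [smul_add, smul_smul, smul_smul, mul_div_cancel₀ _ h.ne', mul_div_cancel₀ _ h.ne'] }
  -- The cone over the projection is already a linear subspace: a negative multiple of $u$ is a
  -- positive multiple of the prolongation of $u$ beyond $0$.
  have hspan : ∀ v ∈ Submodule.span ℝ (Prod.fst '' Q),
      ∃ c : ℝ, 0 ≤ c ∧ ∃ u ∈ Prod.fst '' Q, v = c • u := by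
    intro v hv
    induction hv using Submodule.span_induction with
    | mem x hx => exact ⟨1, zero_le_one, x, hx, by simp⟩
    | zero => exact ⟨0, le_rfl, 0, ⟨q₀, hq₀, hq₀0⟩, by simp⟩
    | add x y _ _ hx hy =>
      obtain ⟨c, hc, u, hu, rfl⟩ := hx
      obtain ⟨c', hc', u', hu', rfl⟩ := hy
      rcases (add_nonneg hc hc').eq_or_lt with h | h
      · have h1 : c = 0 := by linarith
        have h2 : c' = 0 := by linarith
        exact ⟨0, le_rfl, u, hu, by simp [h1, h2]⟩
      · refine ⟨c + c', h.le, _, convex_iff_div.1 hdom hu hu' hc hc' h, ?_⟩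
        rw [smul_add, smul_smul, smul_smul, mul_div_cancel₀ _ h.ne', mul_div_cancel₀ _ h.ne']
    | smul a x _ hx =>
      obtain ⟨c, hc, u, hu, rfl⟩ := hx
      rcases le_total 0 a with ha | ha
      · exact ⟨a * c, mul_nonneg ha hc, u, hu, by rw [mul_smul]⟩
      · obtain ⟨ε, hε, h⟩ := hcore u hu
        refine ⟨-a * c / ε, div_nonneg (mul_nonneg (by linarith) hc) hε.le, _, h, ?_⟩
        rw [zero_add, zero_sub, smul_neg, smul_neg, smul_smul _ ε, div_mul_cancel₀ _ hε.ne', neg_mul,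
          neg_smul, neg_neg, mul_smul]
  -- Riesz extension for the cone `s`, starting from the height functional on $W\times\mathbb R$. A
  -- cone element in this subspace lies over $W\cap\operatorname{span}=0$, where `h0` makes the
  -- height nonnegative.
  obtain ⟨W, hW⟩ := Submodule.exists_isCompl (Submodule.span ℝ (Prod.fst '' Q))
  let f : V × ℝ →ₗ.[ℝ] ℝ := ⟨W.prod ⊤, (LinearMap.snd ℝ V ℝ).domRestrict _⟩
  have hf : ∀ x : f.domain, f x = x.1.2 := fun _ => rfl
  obtain ⟨g, hg, hpos⟩ := riesz_extension s f (by
      rintro ⟨x, hx⟩ ⟨c, hc, q, hq, h⟩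
      have hxW : x.1 ∈ W := hx.1
      change x = c • q at h
      rw [hf]
      change 0 ≤ x.2
      rcases hc.eq_or_lt with hc0 | hc0
      · rw [h, ← hc0]; simp
      have hx0 : x.1 = 0 := by
        refine Submodule.disjoint_def.1 hW.disjoint x.1 ?_ hxW
        rw [h]
        exact Submodule.smul_mem _ _ (Submodule.subset_span ⟨q, hq, rfl⟩)
      have hq1 : q.1 = 0 := by
        have : c • q.1 = 0 := by rw [← hx0, h]; rfl
        exact (smul_eq_zero.1 this).resolve_left hc0.ne'
      have : 0 ≤ q.2 := h0 q.2 (by rw [← hq1]; exact hq)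
      rw [h]
      exact mul_nonneg hc this) (by
      rintro ⟨y, ρ⟩
      obtain ⟨v, hv, w, hw, rfl⟩ := Submodule.mem_sup.1
        (hW.sup_eq_top ▸ Submodule.mem_top : y ∈ Submodule.span ℝ (Prod.fst '' Q) ⊔ W)
      obtain ⟨c, hc, _, ⟨q, hq, rfl⟩, rfl⟩ := hspan v hv
      -- This element of the domain cancels the component in $W$ and corrects the height, so the sum
      -- is `c • q`.
      refine ⟨⟨(-w, c * q.2 - ρ), W.neg_mem hw, trivial⟩, c, hc, q, hq, ?_⟩
      ext1
      · simp
      · simp)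
  have hg' : ∀ r : ℝ, g (0, r) = r := fun r => hg ⟨(0, r), W.zero_mem, trivial⟩
  refine ⟨-(g ∘ₗ LinearMap.inl ℝ V ℝ), fun q hq => ?_⟩
  have h1 : 0 ≤ g q := hpos q ⟨1, zero_le_one, q, hq, by simp⟩
  have h2 : g q = g (q.1, 0) + g (0, q.2) := by rw [← map_add]; simp
  rw [hg'] at h2
  simp only [LinearMap.neg_apply, LinearMap.comp_apply, LinearMap.inl_apply]
  linarith

/-- Fenchel duality for a sum `D + C ∘ A` of convex functions given by their epigraphs. -/
theorem exists_linearMap_split {D : Set (W × ℝ)} {C : Set (V × ℝ)} (hD : Convex ℝ D)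
    (hC : Convex ℝ C) (A : W →ₗ[ℝ] V) (ℓ : W →ₗ[ℝ] ℝ)
    (h : ∀ z r s, (z, r) ∈ D → (A z, s) ∈ C → ℓ z ≤ r + s) {z : W}
    (hzD : z ∈ relCore (Prod.fst '' D)) (hzC : A z ∈ relCore (Prod.fst '' C)) :
    ∃ (m : V →ₗ[ℝ] ℝ) (β : ℝ), (∀ q ∈ C, m q.1 ≤ q.2 + β) ∧
      ∀ q ∈ D, ℓ q.1 - m (A q.1) ≤ q.2 - β := by
  -- `Φ` records the violation of the constraint $q=Ap$ and the excess of the total height over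
  -- $\ell$; `h` says the excess is nonnegative when the violation is zero.
  let Φ : (W × ℝ) × (V × ℝ) →ₗ[ℝ] V × ℝ :=
    LinearMap.prod
      (LinearMap.fst ℝ V ℝ ∘ₗ LinearMap.snd ℝ _ _ -
        A ∘ₗ LinearMap.fst ℝ W ℝ ∘ₗ LinearMap.fst ℝ _ _)
      (LinearMap.snd ℝ W ℝ ∘ₗ LinearMap.fst ℝ _ _ + LinearMap.snd ℝ V ℝ ∘ₗ LinearMap.snd ℝ _ _ -
        ℓ ∘ₗ LinearMap.fst ℝ W ℝ ∘ₗ LinearMap.fst ℝ _ _)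
  have hΦ : ∀ p q, Φ (p, q) = (q.1 - A p.1, p.2 + q.2 - ℓ p.1) := fun _ _ => rfl
  have hDd : Convex ℝ (Prod.fst '' D) := hD.linear_image (LinearMap.fst ℝ W ℝ)
  have hCd : Convex ℝ (Prod.fst '' C) := hC.linear_image (LinearMap.fst ℝ V ℝ)
  obtain ⟨m, hm⟩ := exists_linearMap_le (Q := Φ '' (D ×ˢ C)) ((hD.prod hC).linear_image Φ) (by
      rintro t ⟨⟨p, q⟩, ⟨hp, hq⟩, h'⟩
      rw [hΦ, Prod.mk.injEq, sub_eq_zero] at h'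
      have := h p.1 p.2 q.2 hp (by rw [← h'.1]; exact hq)
      linarith [h'.2]) (by
      obtain ⟨p₀, hp₀, hp₀z⟩ := hzD.1
      obtain ⟨q₀, hq₀, hq₀z⟩ := hzC.1
      refine ⟨⟨_, ⟨(p₀, q₀), ⟨hp₀, hq₀⟩, rfl⟩, ?_⟩, ?_⟩
      · rw [hΦ]
        simp only
        rw [hp₀z, hq₀z, sub_self]
      · rintro _ ⟨_, ⟨⟨p, q⟩, ⟨hp, hq⟩, rfl⟩, rfl⟩
        obtain ⟨ε, ⟨⟨p', hp', h1⟩, ⟨q', hq', h2⟩⟩, hε⟩ :=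
          (((eventually_add_smul_sub_mem hDd hzD ⟨p, hp, rfl⟩).and
            (eventually_add_smul_sub_mem hCd hzC ⟨q, hq, rfl⟩)).and
              self_mem_nhdsWithin).exists
        refine ⟨ε, hε, _, ⟨(p', q'), ⟨hp', hq'⟩, rfl⟩, ?_⟩
        rw [hΦ, hΦ]
        simp only
        rw [h1, h2, map_add, map_smul, map_sub]
        module)
  have hm' : ∀ p ∈ D, ∀ q ∈ C, m q.1 - q.2 ≤ p.2 + m (A p.1) - ℓ p.1 := by
    intro p hp q hq
    have := hm _ ⟨(p, q), ⟨hp, hq⟩, rfl⟩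
    rw [hΦ, map_sub] at this
    linarith
  obtain ⟨p₀, hp₀, -⟩ := hzD.1
  obtain ⟨q₀, hq₀, -⟩ := hzC.1
  -- The inequality decouples into a bound depending on `q` only and one depending on `p` only; `β`
  -- is a number between them.
  obtain ⟨β, hβ₁, hβ₂⟩ := exists_between_of_forall_le
    (s := (fun q : V × ℝ => m q.1 - q.2) '' C)
    (t := (fun p : W × ℝ => p.2 + m (A p.1) - ℓ p.1) '' D) ⟨_, q₀, hq₀, rfl⟩ ⟨_, p₀, hp₀, rfl⟩ (by
      rintro _ ⟨q, hq, rfl⟩ _ ⟨p, hp, rfl⟩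
      exact hm' p hp q hq)
  refine ⟨m, β, fun q hq => ?_, fun p hp => ?_⟩
  · have := hβ₁ ⟨q, hq, rfl⟩
    simp only at this
    linarith
  · have := hβ₂ ⟨p, hp, rfl⟩
    simp only at this
    linarith

end Core

/-! ### Extended-real arithmetic. -/

theorem coe_le_add_of_forall_real {φ : EReal} (hφ : ⊥ < φ) {x β : ℝ}
    (h : ∀ s : ℝ, φ ≤ s → x ≤ s + β) : (x : EReal) ≤ φ + β := by
  induction φ with
  | bot => exact absurd hφ (lt_irrefl _)
  | coe r => exact_mod_cast h r le_rfl
  | top => simp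

theorem coe_sub_le_of_forall_real {φ : EReal} (hφ : ⊥ < φ) {x β : ℝ}
    (h : ∀ s : ℝ, φ ≤ s → x ≤ s + β) : (x : EReal) - φ ≤ β :=
  EReal.sub_le_of_le_add' (coe_le_add_of_forall_real hφ h)

theorem exists_real_eq {φ : EReal} (h₁ : ⊥ < φ) (h₂ : φ < ⊤) : ∃ r : ℝ, φ = r :=
  ⟨φ.toReal, (EReal.coe_toReal h₂.ne h₁.ne').symm⟩

theorem add_lt_top_iff_of_bot_lt {a b : EReal} (ha : ⊥ < a) (hb : ⊥ < b) :
    a + b < ⊤ ↔ a < ⊤ ∧ b < ⊤ := by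
  refine ⟨fun h => ⟨?_, ?_⟩, fun h => EReal.add_lt_top h.1.ne h.2.ne⟩
  · by_contra h'
    rw [not_lt_top_iff] at h'
    rw [h', EReal.top_add_of_ne_bot hb.ne'] at h
    exact lt_irrefl _ h
  · by_contra h'
    rw [not_lt_top_iff] at h'
    rw [h', EReal.add_top_of_ne_bot ha.ne'] at h
    exact lt_irrefl _ h

theorem bot_lt_sum {ι : Type*} {s : Finset ι} {φ : ι → EReal} (h : ∀ i ∈ s, ⊥ < φ i) :
    ⊥ < ∑ i ∈ s, φ i := by
  classical
  induction s using Finset.induction_on with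
  | empty => simp
  | insert a s ha ih =>
    rw [Finset.sum_insert ha, EReal.bot_lt_add_iff]
    exact ⟨h a (by simp), ih fun i hi => h i (by simp [hi])⟩

theorem sum_lt_top_iff {ι : Type*} {s : Finset ι} {φ : ι → EReal} (h : ∀ i ∈ s, ⊥ < φ i) :
    ∑ i ∈ s, φ i < ⊤ ↔ ∀ i ∈ s, φ i < ⊤ := by
  classical
  induction s using Finset.induction_on with
  | empty => simp
  | insert a s ha ih =>
    have hs : ∀ i ∈ s, ⊥ < φ i := fun i hi => h i (by simp [hi])
    rw [Finset.sum_insert ha, add_lt_top_iff_of_bot_lt (h a (by simp)) (bot_lt_sum hs), ih hs]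
    simp

/-! ### Convexity of epigraphs and domains. -/

section Epigraph

variable {E F : Type*} [AddCommGroup E] [Module ℝ E] [AddCommGroup F] [Module ℝ F]

theorem convex_epi_comp {φ : F → EReal} (hφ : Convex ℝ (epi φ)) (A : E →ₗ[ℝ] F) :
    Convex ℝ (epi fun x => φ (A x)) :=
  hφ.linear_preimage (A.prodMap LinearMap.id)

theorem convex_epi_zero : Convex ℝ (epi fun _ : E => (0 : EReal)) := by
  have : epi (fun _ : E => (0 : EReal)) = {q | (0 : ℝ) ≤ LinearMap.snd ℝ E ℝ q} := by
    ext q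
    simp [epi]
  rw [this]
  exact convex_halfSpace_ge (LinearMap.snd ℝ E ℝ).isLinear 0

theorem convex_epi_add {φ ψ : E → EReal} (hφ : Convex ℝ (epi φ)) (hψ : Convex ℝ (epi ψ))
    (hφb : ∀ x, ⊥ < φ x) (hψb : ∀ x, ⊥ < ψ x) : Convex ℝ (epi fun x => φ x + ψ x) := by
  have key : ∀ (x : E) (r : ℝ), φ x + ψ x ≤ r →
      ∃ r₁ r₂ : ℝ, φ x = r₁ ∧ ψ x = r₂ ∧ r₁ + r₂ ≤ r := by
    intro x r h
    obtain ⟨h₁, h₂⟩ := (add_lt_top_iff_of_bot_lt (hφb x) (hψb x)).1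
      (h.trans_lt (EReal.coe_lt_top r))
    obtain ⟨r₁, hr₁⟩ := exists_real_eq (hφb x) h₁
    obtain ⟨r₂, hr₂⟩ := exists_real_eq (hψb x) h₂
    refine ⟨r₁, r₂, hr₁, hr₂, ?_⟩
    rw [hr₁, hr₂] at h
    exact_mod_cast h
  rintro ⟨x, r⟩ hx ⟨y, s⟩ hy a b ha hb hab
  obtain ⟨r₁, r₂, h₁, h₂, h⟩ := key x r hx
  obtain ⟨s₁, s₂, h₁', h₂', h'⟩ := key y s hy
  have e₁ : φ (a • x + b • y) ≤ ((a * r₁ + b * s₁ : ℝ) : EReal) :=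
    hφ (show (x, r₁) ∈ epi φ from h₁.le) (show (y, s₁) ∈ epi φ from h₁'.le) ha hb hab
  have e₂ : ψ (a • x + b • y) ≤ ((a * r₂ + b * s₂ : ℝ) : EReal) :=
    hψ (show (x, r₂) ∈ epi ψ from h₂.le) (show (y, s₂) ∈ epi ψ from h₂'.le) ha hb hab
  change φ (a • x + b • y) + ψ (a • x + b • y) ≤ ((a * r + b * s : ℝ) : EReal)
  refine (add_le_add e₁ e₂).trans ?_
  norm_cast
  nlinarith [mul_le_mul_of_nonneg_left h ha, mul_le_mul_of_nonneg_left h' hb]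

theorem convex_epi_sum {ι : Type*} {s : Finset ι} {φ : ι → E → EReal}
    (hφ : ∀ i ∈ s, Convex ℝ (epi (φ i))) (hb : ∀ i ∈ s, ∀ x, ⊥ < φ i x) :
    Convex ℝ (epi fun x => ∑ i ∈ s, φ i x) := by
  classical
  induction s using Finset.induction_on with
  | empty => simpa using convex_epi_zero
  | insert a s ha ih =>
    simp only [Finset.sum_insert ha]
    exact convex_epi_add (hφ a (by simp)) (ih (fun i hi => hφ i (by simp [hi]))
      fun i hi => hb i (by simp [hi])) (hb a (by simp))
      fun x => bot_lt_sum fun i hi => hb i (by simp [hi]) x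

theorem image_fst_epi {X : Type*} {φ : X → EReal} (hb : ∀ x, ⊥ < φ x) :
    Prod.fst '' epi φ = dom φ := by
  ext x
  constructor
  · rintro ⟨⟨x, r⟩, h, rfl⟩
    exact lt_of_le_of_lt h (EReal.coe_lt_top r)
  · intro h
    obtain ⟨r, hr⟩ := exists_real_eq (hb x) h
    exact ⟨(x, r), hr.le, rfl⟩

theorem convex_dom {φ : E → EReal} (hφ : Convex ℝ (epi φ)) (hb : ∀ x, ⊥ < φ x) :
    Convex ℝ (dom φ) := by
  rw [← image_fst_epi hb]
  exact hφ.linear_image (LinearMap.fst ℝ E ℝ)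

end Epigraph

/-! ### Duality along a path. -/

section Chain

variable {X : Type*}

/-- Cost of the path `z_τ, …, z_T` with running cost `M` and terminal cost `h`. -/
noncomputable def chainCost (M : ℕ → X × X → EReal) (h : X → EReal) (T τ : ℕ) (z : ℕ → X) : EReal :=
  (∑ t ∈ Finset.Ioc τ T, M t (z (t - 1), z t)) + h (z T)

variable {M : ℕ → X × X → EReal} {h : X → EReal} {T τ : ℕ}

theorem bot_lt_chainCost (hMb : ∀ t ∈ Finset.Ioc τ T, ∀ q, ⊥ < M t q) (hhb : ∀ a, ⊥ < h a)
    (z : ℕ → X) : ⊥ < chainCost M h T τ z :=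
  EReal.bot_lt_add_iff.2 ⟨bot_lt_sum fun t ht => hMb t ht _, hhb _⟩

theorem chainCost_lt_top_iff (hMb : ∀ t ∈ Finset.Ioc τ T, ∀ q, ⊥ < M t q) (hhb : ∀ a, ⊥ < h a)
    (z : ℕ → X) : chainCost M h T τ z < ⊤ ↔
      (∀ t ∈ Finset.Ioc τ T, M t (z (t - 1), z t) < ⊤) ∧ h (z T) < ⊤ := by
  rw [chainCost, add_lt_top_iff_of_bot_lt (bot_lt_sum fun t ht => hMb t ht _) (hhb _),
    sum_lt_top_iff fun t ht => hMb t ht _]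

theorem sum_Ioc_eq_add_sum_Ioc_succ {G : Type*} [AddCommMonoid G] (f : ℕ → G) (hτ : τ < T) :
    ∑ t ∈ Finset.Ioc τ T, f t = f (τ + 1) + ∑ t ∈ Finset.Ioc (τ + 1) T, f t := by
  rw [← Finset.sum_insert (by simp)]
  congr 1
  ext t
  simp only [Finset.mem_Ioc, Finset.mem_insert]
  omega

variable {V : Type*} [AddCommGroup V] [Module ℝ V] {M : ℕ → V × V → EReal} {h : V → EReal}

/-- The linear map that evaluates a path at the endpoints of a step. -/
def stepMap (V : Type*) [AddCommGroup V] [Module ℝ V] (t : ℕ) : (ℕ → V) →ₗ[ℝ] V × V :=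
  (LinearMap.proj (t - 1)).prod (LinearMap.proj t)

theorem convex_epi_chainCost (hM : ∀ t ∈ Finset.Ioc τ T, Convex ℝ (epi (M t)))
    (hMb : ∀ t ∈ Finset.Ioc τ T, ∀ q, ⊥ < M t q) (hh : Convex ℝ (epi h)) (hhb : ∀ a, ⊥ < h a) :
    Convex ℝ (epi (chainCost M h T τ)) := by
  refine convex_epi_add (convex_epi_sum (φ := fun t (z : ℕ → V) => M t (z (t - 1), z t))
    (fun t ht => ?_) fun t ht (z : ℕ → V) => hMb t ht (z (t - 1), z t)) ?_ (fun z => bot_lt_sum fun t ht => hMb t ht _)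
    fun z => hhb _
  · exact convex_epi_comp (hM t ht) (stepMap V t)
  · exact convex_epi_comp hh (LinearMap.proj T : (ℕ → V) →ₗ[ℝ] V)

theorem mem_relCore_dom_chainCost (hM : ∀ t ∈ Finset.Ioc τ T, Convex ℝ (epi (M t)))
    (hMb : ∀ t ∈ Finset.Ioc τ T, ∀ q, ⊥ < M t q) (hh : Convex ℝ (epi h)) (hhb : ∀ a, ⊥ < h a)
    {z : ℕ → V} (hz : ∀ t ∈ Finset.Ioc τ T, (z (t - 1), z t) ∈ relCore (dom (M t)))
    (hzT : z T ∈ relCore (dom h)) : z ∈ relCore (dom (chainCost M h T τ)) := by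
  have hdom : ∀ z, z ∈ dom (chainCost M h T τ) ↔
      (∀ t ∈ Finset.Ioc τ T, (z (t - 1), z t) ∈ dom (M t)) ∧ z T ∈ dom h :=
    chainCost_lt_top_iff hMb hhb
  refine ⟨(hdom z).2 ⟨fun t ht => (hz t ht).1, hzT.1⟩, fun z' hz' => ?_⟩
  rw [hdom] at hz'
  have h₁ : ∀ᶠ ε : ℝ in 𝓝[>] 0, ∀ t ∈ Finset.Ioc τ T,
      (z (t - 1), z t) + ε • ((z (t - 1), z t) - (z' (t - 1), z' t)) ∈ dom (M t) :=
    (Finset.eventually_all _).2 fun t ht =>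
      eventually_add_smul_sub_mem (convex_dom (hM t ht) (hMb t ht)) (hz t ht) (hz'.1 t ht)
  obtain ⟨ε, ⟨h₁, h₂⟩, hε⟩ := ((h₁.and
    (eventually_add_smul_sub_mem (convex_dom hh hhb) hzT hz'.2)).and self_mem_nhdsWithin).exists
  exact ⟨ε, hε, (hdom _).2 ⟨h₁, h₂⟩⟩

theorem relCore_image {E F : Type*} [AddCommGroup E] [Module ℝ E] [AddCommGroup F] [Module ℝ F]
    {C : Set E} {z : E} (hz : z ∈ relCore C) (A : E →ₗ[ℝ] F) : A z ∈ relCore (A '' C) := by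
  refine ⟨⟨z, hz.1, rfl⟩, ?_⟩
  rintro _ ⟨z', hz', rfl⟩
  obtain ⟨ε, hε, h⟩ := hz.2 z' hz'
  exact ⟨ε, hε, _, h, by simp⟩

/-- Fenchel duality, with dual attainment, for paths with a convex running cost and a convex
terminal cost. -/
theorem exists_dual_path (hτ : τ ≤ T) (hM : ∀ t ∈ Finset.Ioc τ T, Convex ℝ (epi (M t)))
    (hMb : ∀ t ∈ Finset.Ioc τ T, ∀ q, ⊥ < M t q) (hh : Convex ℝ (epi h)) (hhb : ∀ a, ⊥ < h a)
    {z : ℕ → V} (hz : ∀ t ∈ Finset.Ioc τ T, (z (t - 1), z t) ∈ relCore (dom (M t)))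
    (hzT : z T ∈ relCore (dom h)) (c : V →ₗ[ℝ] ℝ) (α : ℝ)
    (hc : ∀ x : ℕ → V, (c (x τ) : EReal) ≤ chainCost M h T τ x + α) :
    ∃ y : ℕ → V →ₗ[ℝ] ℝ, y τ = c ∧
      (∑ t ∈ Finset.Ioc τ T, ⨆ q : V × V, ((y (t - 1) q.1 - y t q.2 : ℝ) : EReal) - M t q) +
        (⨆ a : V, (y T a : EReal) - h a) ≤ α := by
  obtain ⟨k, rfl⟩ := Nat.exists_eq_add_of_le hτ
  clear hτ
  -- Induction on the number of steps, peeling off the first one; `c` and `α` vary because the tail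
  -- inherits a new functional and a new constant.
  induction k generalizing τ c α with
  | zero =>
    refine ⟨fun _ => c, rfl, ?_⟩
    simp only [add_zero, Finset.Ioc_self, Finset.sum_empty, zero_add]
    refine iSup_le fun a => EReal.sub_le_of_le_add' ?_
    simpa [chainCost] using hc fun _ => a
  | succ k ih =>
    have hlt : τ < τ + (k + 1) := by omega
    have hT : τ + (k + 1) = τ + 1 + k := by omega
    have hmem : τ + 1 ∈ Finset.Ioc τ (τ + (k + 1)) := by simp
    have hsub : ∀ t ∈ Finset.Ioc (τ + 1) (τ + 1 + k), t ∈ Finset.Ioc τ (τ + (k + 1)) := by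
      intro t ht
      rw [Finset.mem_Ioc] at ht ⊢
      omega
    have hsplit : ∀ x, chainCost M h (τ + (k + 1)) τ x =
        M (τ + 1) (x τ, x (τ + 1)) + chainCost M h (τ + 1 + k) (τ + 1) x := by
      intro x
      simp only [chainCost]
      rw [sum_Ioc_eq_add_sum_Ioc_succ _ hlt, add_assoc]
      simp only [Nat.add_sub_cancel, hT]
    have hMs := fun t ht => hM t (hsub t ht)
    have hMbs := fun t ht => hMb t (hsub t ht)
    have hzs := fun t ht => hz t (hsub t ht)
    rw [hT] at hzT
    have hVb := bot_lt_chainCost hMbs hhb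
    have hVc := convex_epi_chainCost hMs hMbs hh hhb
    have hVz := relCore_image (mem_relCore_dom_chainCost hMs hMbs hh hhb hzs hzT)
      (LinearMap.proj (τ + 1))
    -- The constant `α` is absorbed into the first step cost. `C` is a projection of the epigraph of
    -- the tail cost, so neither finiteness nor attainment of the tail value function is needed.
    let D : Set ((V × V) × ℝ) := {q | (q.1, q.2 - α) ∈ epi (M (τ + 1))}
    let C : Set (V × ℝ) := (LinearMap.prodMap (LinearMap.proj (τ + 1)) LinearMap.id :
      (ℕ → V) × ℝ →ₗ[ℝ] V × ℝ) '' epi (chainCost M h (τ + 1 + k) (τ + 1))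
    have hD : Convex ℝ D := by
      rintro ⟨q, r⟩ hq ⟨q', r'⟩ hq' a b ha hb hab
      change (a • q + b • q', a * r + b * r' - α) ∈ epi (M (τ + 1))
      have := hM _ hmem hq hq' ha hb hab
      convert this using 1
      ext1
      · rfl
      · simp only [Prod.snd_add, Prod.smul_snd, smul_eq_mul]
        linear_combination α * hab
    have hC : Convex ℝ C := hVc.linear_image _
    have hDd : Prod.fst '' D = dom (M (τ + 1)) := by
      rw [← image_fst_epi (hMb _ hmem)]
      ext q
      constructor
      · rintro ⟨p, hp, rfl⟩
        exact ⟨_, hp, rfl⟩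
      · rintro ⟨p, hp, rfl⟩
        exact ⟨(p.1, p.2 + α), by simpa [D] using hp, rfl⟩
    have hCd : Prod.fst '' C = (LinearMap.proj (τ + 1) : (ℕ → V) →ₗ[ℝ] V) ''
        dom (chainCost M h (τ + 1 + k) (τ + 1)) := by
      rw [← image_fst_epi hVb, Set.image_image, Set.image_image]
      rfl
    obtain ⟨m, β, hm₁, hm₂⟩ := exists_linearMap_split hD hC (LinearMap.snd ℝ V V)
      (c ∘ₗ LinearMap.fst ℝ V V) (by
        rintro ⟨a, b⟩ r s hr ⟨⟨x, s'⟩, hx, hxs⟩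
        rw [LinearMap.prodMap_apply, Prod.mk.injEq] at hxs
        obtain ⟨rfl : x (τ + 1) = b, rfl : s' = s⟩ := hxs
        -- The tail cost ignores `x τ`, so the first state can be reset to `a`.
        have := hc (Function.update x τ a)
        rw [hsplit] at this
        have hcost : chainCost M h (τ + 1 + k) (τ + 1) (Function.update x τ a) =
            chainCost M h (τ + 1 + k) (τ + 1) x := by
          simp only [chainCost]
          rw [Function.update_of_ne (by omega)]
          congr 1
          refine Finset.sum_congr rfl fun t ht => ?_
          rw [Finset.mem_Ioc] at ht
          rw [Function.update_of_ne (by omega), Function.update_of_ne (by omega)]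
        rw [hcost, Function.update_self, Function.update_of_ne (by omega)] at this
        have h₁ : M (τ + 1) (a, x (τ + 1)) ≤ ((r - α : ℝ) : EReal) := hr
        have h₂ : chainCost M h (τ + 1 + k) (τ + 1) x ≤ (s' : EReal) := hx
        have h₃ := this.trans (add_le_add_left (add_le_add h₁ h₂) _)
        change c a ≤ r + s'
        have h₄ : c a ≤ r - α + s' + α := by exact_mod_cast h₃
        linarith)
      (z := (z τ, z (τ + 1))) (by rw [hDd]; simpa using hz _ hmem) (by rw [hCd]; exact hVz)
    -- The tail starts from `m` and `β`; the first step is left with the budget $\alpha-\beta$.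
    obtain ⟨y, hy, hyα⟩ := ih m β hMs hMbs hzs hzT fun x =>
      coe_le_add_of_forall_real (hVb x) fun s hs =>
        hm₁ (x (τ + 1), s) ⟨(x, s), hs, rfl⟩
    refine ⟨Function.update y τ c, Function.update_self .., ?_⟩
    rw [sum_Ioc_eq_add_sum_Ioc_succ _ hlt, add_assoc]
    have hα : (α : EReal) = ((α - β : ℝ) : EReal) + (β : EReal) := by
      norm_cast
      ring
    rw [hα]
    refine add_le_add ?_ (le_of_eq_of_le ?_ hyα)
    · rw [Nat.add_sub_cancel, Function.update_self, Function.update_of_ne (by omega), hy]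
      refine iSup_le fun q => coe_sub_le_of_forall_real (hMb _ hmem q) fun s hs => ?_
      have := hm₂ (q, s + α) (by
        change M (τ + 1) q ≤ ((s + α - α : ℝ) : EReal)
        rwa [add_sub_cancel_right])
      simp only [LinearMap.comp_apply, LinearMap.fst_apply, LinearMap.snd_apply] at this
      linarith
    · rw [Function.update_of_ne (by omega), hT]
      congr 1
      refine Finset.sum_congr rfl fun t ht => ?_
      rw [Finset.mem_Ioc] at ht
      rw [Function.update_of_ne (by omega), Function.update_of_ne (by omega)]

end Chain

/-! ### Affine minorants of convex l.s.c. functions. -/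

section Minorant

theorem isClosed_epi {X : Type*} [TopologicalSpace X] {φ : X → EReal} (hφ : LowerSemicontinuous φ) : IsClosed (epi φ) := by
  have h : IsClosed {p : X × EReal | φ p.1 ≤ p.2} := hφ.isClosed_epigraph
  exact h.preimage (continuous_fst.prodMk (continuous_coe_real_ereal.comp continuous_snd))

variable {E : Type*} [NormedAddCommGroup E] [NormedSpace ℝ E]

/-- A point strictly below the graph is separated from the epigraph by a closed hyperplane that is
not tilted past the vertical. -/
theorem exists_separating_hyperplane {φ : E → EReal} (hφ : IsProperConvexLsc φ) {x : E} {r : ℝ}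
    (hr : (r : EReal) < φ x) :
    ∃ (g : E →L[ℝ] ℝ) (k u : ℝ), 0 ≤ k ∧ g x + k * r < u ∧
      ∀ z (s : ℝ), φ z ≤ s → u < g z + k * s := by
  obtain ⟨f, u, hfx, hf⟩ := geometric_hahn_banach_point_closed hφ.convex (isClosed_epi hφ.lsc)
    (x := (x, r)) (fun h => absurd hr (not_lt.2 h))
  have hdec : ∀ z s, f (z, s) = f (z, 0) + f (0, 1) * s := by
    intro z s
    have : (z, s) = (z, (0 : ℝ)) + s • ((0 : E), (1 : ℝ)) := by simp
    rw [this, map_add, map_smul, smul_eq_mul, mul_comm]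
  have hepi : ∀ z (s : ℝ), φ z ≤ s → u < f (z, 0) + f (0, 1) * s := by
    intro z s hs
    rw [← hdec]
    exact hf (z, s) hs
  refine ⟨f ∘L ContinuousLinearMap.inl ℝ E ℝ, f (0, 1), u, ?_, ?_, hepi⟩
  -- With a negative vertical coefficient, going up over a point of the domain would violate the
  -- separation.
  · by_contra! hk
    obtain ⟨z, hz⟩ := hφ.proper.1
    obtain ⟨s, hs⟩ := exists_real_eq (hφ.proper.2 z) hz
    obtain ⟨N, hN⟩ := exists_nat_gt ((f (z, 0) + f (0, 1) * s - u) / -f (0, 1))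
    rw [div_lt_iff₀ (by linarith)] at hN
    have := hepi z (s + N) (by
      rw [hs]
      exact_mod_cast le_add_of_nonneg_right (Nat.cast_nonneg N))
    linarith [mul_add (f (0, 1)) s N, mul_comm (N : ℝ) (f (0, 1))]
  · have := hdec x r
    rw [this] at hfx
    exact hfx

theorem exists_affine_minorant_of_pos {φ : E → EReal} {x : E} {r : ℝ}
    {g : E →L[ℝ] ℝ} {k u : ℝ} (hk : 0 < k) (hx : g x + k * r < u)
    (hg : ∀ z (s : ℝ), φ z ≤ s → u < g z + k * s) :
    ∃ (m : E →L[ℝ] ℝ) (β : ℝ), (∀ z (s : ℝ), φ z ≤ s → m z - β ≤ s) ∧ r < m x - β := by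
  have hm : ∀ z, (-(k⁻¹ • g)) z - -(k⁻¹ * u) = (u - g z) / k := by
    intro z
    simp only [neg_apply, smul_apply, smul_eq_mul]
    field_simp
    ring
  refine ⟨-(k⁻¹ • g), -(k⁻¹ * u), fun z s hs => ?_, ?_⟩
  · rw [hm, div_le_iff₀ hk]
    linarith [hg z s hs, mul_comm k s]
  · rw [hm, lt_div_iff₀ hk]
    linarith [mul_comm k r]

/-- A proper convex lower semicontinuous function is the supremum of its continuous affine
minorants. -/
theorem exists_affine_minorant {φ : E → EReal} (hφ : IsProperConvexLsc φ) {x : E} {r : ℝ}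
    (hr : (r : EReal) < φ x) :
    ∃ (m : E →L[ℝ] ℝ) (β : ℝ), (∀ z (s : ℝ), φ z ≤ s → m z - β ≤ s) ∧ r < m x - β := by
  obtain ⟨g, k, u, hk, hx, hg⟩ := exists_separating_hyperplane hφ hr
  rcases hk.eq_or_lt with rfl | hk
  swap
  · exact exists_affine_minorant_of_pos hk hx hg
  -- The hyperplane is vertical. Separating a point just below the graph over `z` in the domain
  -- cannot give a vertical one, so some affine minorant exists.
  obtain ⟨z, hz⟩ := hφ.proper.1
  obtain ⟨s, hs⟩ := exists_real_eq (hφ.proper.2 z) hz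
  obtain ⟨g', k', u', hk', hx', hg'⟩ := exists_separating_hyperplane hφ (x := z) (r := s - 1) (by
    rw [hs]
    exact_mod_cast sub_one_lt s)
  have hk'' : 0 < k' := by
    rcases hk'.eq_or_lt with h | h
    · have := hg' z s hs.le
      rw [← h] at this hx'
      linarith
    · exact h
  obtain ⟨m, β, hm, -⟩ := exists_affine_minorant_of_pos hk'' hx' hg'
  -- Adding $N(u-g)$ keeps a minorant, as this is negative on the domain, and lifts its value at `x`
  -- above `r`, as $u-g(x)>0$.
  obtain ⟨N, hN⟩ := exists_nat_gt ((r - (m x - β)) / (u - g x))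
  rw [div_lt_iff₀ (by linarith)] at hN
  refine ⟨m - (N : ℝ) • g, β - N * u, fun y t ht => ?_, ?_⟩
  · have h₁ := hm y t ht
    have h₂ := mul_le_mul_of_nonneg_left (hg y t ht).le (Nat.cast_nonneg (α := ℝ) N)
    simp only [sub_apply, smul_apply, smul_eq_mul]
    linarith
  · simp only [sub_apply, smul_apply, smul_eq_mul]
    linarith

end Minorant

/-! ### Suprema of affine functions. -/

section SupAffine

theorem lowerSemicontinuous_iSup_sub {X E : Type*} [TopologicalSpace E] (A : X → E → ℝ)
    (hA : ∀ x, Continuous (A x)) (φ : X → EReal) :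
    LowerSemicontinuous fun y => ⨆ x, ((A x y : ℝ) : EReal) - φ x := by
  refine lowerSemicontinuous_iSup fun x => Continuous.lowerSemicontinuous ?_
  cases φ x with
  | bot => simpa using continuous_const
  | top => simpa using continuous_const
  | coe c => exact continuous_coe_real_ereal.comp ((hA x).sub continuous_const)

variable {X E : Type*} [AddCommGroup E] [Module ℝ E]

theorem convex_epi_iSup_sub (A : X → E →ₗ[ℝ] ℝ) (φ : X → EReal) :
    Convex ℝ (epi fun y => ⨆ x, ((A x y : ℝ) : EReal) - φ x) := by
  have : (epi fun y => ⨆ x, ((A x y : ℝ) : EReal) - φ x) =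
      ⋂ x, epi fun y => ((A x y : ℝ) : EReal) - φ x := by
    ext q
    simp [epi]
  rw [this]
  refine convex_iInter fun x => ?_
  cases h : φ x with
  | bot => simpa [epi] using convex_empty
  | top => simpa [epi] using convex_univ
  | coe c =>
    rintro ⟨y, r⟩ hy ⟨y', r'⟩ hy' a b ha hb hab
    have h₁ : A x y - c ≤ r := by
      have : ((A x y : ℝ) : EReal) - c ≤ r := hy
      exact_mod_cast this
    have h₂ : A x y' - c ≤ r' := by
      have : ((A x y' : ℝ) : EReal) - c ≤ r' := hy'
      exact_mod_cast this
    change ((A x (a • y + b • y') : ℝ) : EReal) - c ≤ ((a * r + b * r' : ℝ) : EReal)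
    norm_cast
    rw [map_add, map_smul, map_smul, smul_eq_mul, smul_eq_mul]
    have h₃ := mul_le_mul_of_nonneg_left h₁ ha
    have h₄ := mul_le_mul_of_nonneg_left h₂ hb
    have h₅ : c = a * c + b * c := by rw [← add_mul, hab, one_mul]
    linarith

theorem bot_lt_coe_sub {a : ℝ} {b : EReal} (hb : b < ⊤) : ⊥ < (a : EReal) - b := by
  rw [sub_eq_add_neg, EReal.bot_lt_add_iff]
  exact ⟨EReal.bot_lt_coe a, by rwa [← EReal.neg_top, EReal.neg_lt_neg_iff]⟩

theorem bot_lt_iSup_sub (A : X → ℝ) {φ : X → EReal} (hφ : (dom φ).Nonempty) :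
    ⊥ < ⨆ x, ((A x : ℝ) : EReal) - φ x := by
  obtain ⟨x, hx⟩ := hφ
  exact (bot_lt_coe_sub hx).trans_le (le_iSup (fun x => ((A x : ℝ) : EReal) - φ x) x)

theorem coe_le_add_of_coe_sub_le {a : ℝ} {b c : EReal} (hb : ⊥ < b) (hc : ⊥ < c)
    (h : (a : EReal) - b ≤ c) : (a : EReal) ≤ b + c := by
  rw [add_comm]
  exact (EReal.sub_le_iff_le_add (.inl hb.ne') (.inr hc.ne')).1 h

theorem coe_sub_iInf_le {ι : Sort*} {a : ℝ} {c : EReal} {d : ι → EReal} (hc : ⊥ < c)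
    (h : ∀ i, (a : EReal) ≤ c + d i) : (a : EReal) - ⨅ i, d i ≤ c := by
  induction c with
  | bot => exact absurd hc (lt_irrefl _)
  | coe r =>
    have : (a : EReal) - r ≤ ⨅ i, d i := le_iInf fun i => EReal.sub_le_of_le_add' (h i)
    refine EReal.sub_le_of_le_add ?_
    rw [add_comm]
    exact (EReal.sub_le_iff_le_add (.inl (EReal.coe_ne_bot r)) (.inl (EReal.coe_ne_top r))).1 this
  | top => exact le_top

end SupAffine

/-! ### Conjugate costs and weak duality. -/

variable {n : ℕ}

theorem exists_inner_eq (f : Vec n →ₗ[ℝ] ℝ) : ∃ x : Vec n, ∀ a, f a = inner ℝ x a :=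
  ⟨(InnerProductSpace.toDual ℝ (Vec n)).symm (LinearMap.toContinuousLinearMap f), fun a => by
    simp⟩

theorem convex_epi_conj (φ : Vec n → EReal) : Convex ℝ (epi (conj φ)) :=
  convex_epi_iSup_sub (fun x => innerₗ (Vec n) x) φ

theorem lowerSemicontinuous_conj (φ : Vec n → EReal) : LowerSemicontinuous (conj φ) :=
  lowerSemicontinuous_iSup_sub (fun x y => inner ℝ x y) (fun x => by fun_prop) φ

theorem bot_lt_conj {φ : Vec n → EReal} (hφ : (dom φ).Nonempty) (y : Vec n) : ⊥ < conj φ y :=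
  bot_lt_iSup_sub (fun x => inner ℝ x y) hφ

theorem inner_sub_le_conj (φ : Vec n → EReal) (x y : Vec n) :
    ((inner ℝ x y : ℝ) : EReal) - φ x ≤ conj φ y :=
  le_iSup (fun x => ((inner ℝ x y : ℝ) : EReal) - φ x) x

theorem convex_epi_dualTerminal (g : Vec n → EReal) : Convex ℝ (epi (dualTerminal g)) :=
  convex_epi_comp (convex_epi_conj g) (-LinearMap.id)

theorem bot_lt_dualTerminal {g : Vec n → EReal} (hg : (dom g).Nonempty) (b : Vec n) :
    ⊥ < dualTerminal g b :=
  bot_lt_conj hg _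

variable {L : ℕ → Vec n × Vec n → EReal} {g : Vec n → EReal} {T t τ : ℕ}

theorem inner_add_inner_sub_le_dualLagrangian (L : ℕ → Vec n × Vec n → EReal) (t : ℕ)
    (x v p w : Vec n) :
    ((inner ℝ x w + inner ℝ v p : ℝ) : EReal) - L t (x, v) ≤ dualLagrangian L t (p, w) :=
  le_iSup (fun z : Vec n × Vec n =>
    ((inner ℝ z.1 w + inner ℝ z.2 p : ℝ) : EReal) - L t z) (x, v)

theorem convex_epi_dualLagrangian (L : ℕ → Vec n × Vec n → EReal) (t : ℕ) :
    Convex ℝ (epi (dualLagrangian L t)) := by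
  let A : Vec n × Vec n → Vec n × Vec n →ₗ[ℝ] ℝ := fun z =>
    innerₗ (Vec n) z.1 ∘ₗ LinearMap.snd ℝ _ _ + innerₗ (Vec n) z.2 ∘ₗ LinearMap.fst ℝ _ _
  have hA : ∀ z q, inner ℝ z.1 q.2 + inner ℝ z.2 q.1 = A z q := fun _ _ => rfl
  have h : dualLagrangian L t = fun q => ⨆ z, ((A z q : ℝ) : EReal) - L t z := by
    funext q
    simp only [dualLagrangian, hA]
  rw [h]
  exact convex_epi_iSup_sub A (L t)

theorem bot_lt_dualLagrangian (hL : (dom (L t)).Nonempty) (q : Vec n × Vec n) :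
    ⊥ < dualLagrangian L t q :=
  bot_lt_iSup_sub (fun z : Vec n × Vec n => inner ℝ z.1 q.2 + inner ℝ z.2 q.1) hL

/-- Biconjugation $g^{**}\ge g$: the slope of an affine minorant with value above `r` at `x` is the
required dual point. -/
theorem exists_lt_inner_sub_dualTerminal (hg : IsProperConvexLsc g) {x : Vec n} {r : ℝ}
    (hr : (r : EReal) < g x) :
    ∃ b : Vec n, (r : EReal) ≤ ((inner ℝ x (-b) : ℝ) : EReal) - dualTerminal g b := by
  obtain ⟨m, β, hm, hx⟩ := exists_affine_minorant hg hr
  obtain ⟨y, hy⟩ := exists_inner_eq (m : Vec n →ₗ[ℝ] ℝ)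
  have hy' : ∀ a, m a = inner ℝ a y := fun a => by rw [real_inner_comm]; exact hy a
  have h : dualTerminal g (-y) ≤ (β : EReal) := by
    refine iSup_le fun z => coe_sub_le_of_forall_real (hg.proper.2 z) fun s hs => ?_
    rw [neg_neg, ← hy']
    linarith [hm z s hs]
  refine ⟨-y, le_trans ?_ (EReal.sub_le_sub le_rfl h)⟩
  rw [neg_neg, ← hy']
  exact_mod_cast hx.le

theorem exists_lt_inner_sub_dualLagrangian (hL : IsProperConvexLsc (L t)) {x v : Vec n} {r : ℝ}
    (hr : (r : EReal) < L t (x, v)) :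
    ∃ p w : Vec n, (r : EReal) ≤
      ((inner ℝ x w + inner ℝ v p : ℝ) : EReal) - dualLagrangian L t (p, w) := by
  obtain ⟨m, β, hm, hx⟩ := exists_affine_minorant hL hr
  obtain ⟨w, hw⟩ := exists_inner_eq ((m : Vec n × Vec n →ₗ[ℝ] ℝ) ∘ₗ LinearMap.inl ℝ _ _)
  obtain ⟨p, hp⟩ := exists_inner_eq ((m : Vec n × Vec n →ₗ[ℝ] ℝ) ∘ₗ LinearMap.inr ℝ _ _)
  have hm' : ∀ z, m z = inner ℝ z.1 w + inner ℝ z.2 p := fun z => by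
    rw [real_inner_comm, ← hw, real_inner_comm, ← hp]
    simp [← map_add]
  have h : dualLagrangian L t (p, w) ≤ (β : EReal) := by
    refine iSup_le fun z => coe_sub_le_of_forall_real (hL.proper.2 z) fun s hs => ?_
    rw [← hm']
    linarith [hm z s hs]
  refine ⟨p, w, le_trans ?_ (EReal.sub_le_sub le_rfl h)⟩
  rw [← hm' (x, v)]
  exact_mod_cast hx.le

theorem le_of_forall_real_lt_le {a b : EReal} (h : ∀ r : ℝ, (r : EReal) < a → (r : EReal) ≤ b) :
    a ≤ b := by
  by_contra! hba
  obtain ⟨r, h₁, h₂⟩ := EReal.lt_iff_exists_real_btwn.1 hba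
  exact absurd (h r h₂) (not_le.2 h₁)

theorem ereal_coe_sum {ι : Type*} (s : Finset ι) (f : ι → ℝ) :
    ((∑ i ∈ s, f i : ℝ) : EReal) = ∑ i ∈ s, (f i : EReal) :=
  map_sum (⟨⟨Real.toEReal, EReal.coe_zero⟩, EReal.coe_add⟩ : ℝ →+ EReal) f s

/-- Weak duality. -/
theorem neg_inner_le_primalCost_add_dualCost (hτ : τ ≤ T)
    (hL : ∀ t ∈ Finset.Ioc τ T, IsProper (L t)) (hg : IsProper g) (x p : ℕ → Vec n) :
    ((-inner ℝ (x τ) (p τ) : ℝ) : EReal) ≤ primalCost L g T τ x + dualCost L g T τ p := by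
  have htel : ∑ t ∈ Finset.Ioc τ T, (inner ℝ (x (t - 1)) (p t - p (t - 1)) +
      inner ℝ (x t - x (t - 1)) (p t)) = inner ℝ (x T) (p T) - inner ℝ (x τ) (p τ) := by
    induction T, hτ using Nat.le_induction with
    | base => simp
    | succ T hT ih =>
      rw [Finset.sum_Ioc_succ_top (by omega), ih (fun t ht => hL t (by
        rw [Finset.mem_Ioc] at ht ⊢
        omega)), Nat.add_sub_cancel, inner_sub_right, inner_sub_left]
      ring
  have h₁ : ((∑ t ∈ Finset.Ioc τ T, (inner ℝ (x (t - 1)) (p t - p (t - 1)) +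
      inner ℝ (x t - x (t - 1)) (p t)) : ℝ) : EReal) ≤
      ∑ t ∈ Finset.Ioc τ T, (L t (x (t - 1), x t - x (t - 1)) +
        dualLagrangian L t (p t, p t - p (t - 1))) := by
    rw [ereal_coe_sum]
    exact Finset.sum_le_sum fun t ht => coe_le_add_of_coe_sub_le ((hL t ht).2 _)
      (bot_lt_dualLagrangian (hL t ht).1 _) (inner_add_inner_sub_le_dualLagrangian L t _ _ _ _)
  have h₂ : ((inner ℝ (x T) (-p T) : ℝ) : EReal) ≤ g (x T) + dualTerminal g (p T) :=
    coe_le_add_of_coe_sub_le (hg.2 _) (bot_lt_dualTerminal hg.1 _) (inner_sub_le_conj g _ _)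
  have h₃ := add_le_add h₁ h₂
  rw [htel, Finset.sum_add_distrib, add_add_add_comm] at h₃
  refine le_of_eq_of_le ?_ h₃
  norm_cast
  rw [inner_neg_right]
  ring

/-! ### Strict feasibility in terms of the endpoints of a step. -/

theorem setOf_exists_real_eq {X : Type*} {φ : X → EReal} (hb : ∀ x, ⊥ < φ x) :
    {x | ∃ r : ℝ, φ x = r} = dom φ := by
  ext x
  refine ⟨?_, exists_real_eq (hb x)⟩
  rintro ⟨r, hr⟩
  change φ x < ⊤
  rw [hr]
  exact EReal.coe_lt_top r

/-- State and velocity conditions combine by `mem_relCore_of_sections`; the shear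
$(x,v)\mapsto(x,x+v)$ carries the result to endpoints. -/
theorem mem_relCore_dom_step {ψ : Vec n × Vec n → EReal} (hψ : Convex ℝ (epi ψ))
    (hb : ∀ q, ⊥ < ψ q) {a b : Vec n}
    (ha : a ∈ intrinsicInterior ℝ {x | {v | ∃ r : ℝ, ψ (x, v) = r}.Nonempty})
    (hab : b - a ∈ intrinsicInterior ℝ {v | ∃ r : ℝ, ψ (a, v) = r}) :
    (a, b) ∈ relCore (dom fun q : Vec n × Vec n => ψ (q.1, q.2 - q.1)) := by
  have hset : ∀ x, {v | ∃ r : ℝ, ψ (x, v) = r} = {v | (x, v) ∈ dom ψ} := fun x =>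
    setOf_exists_real_eq (φ := fun v => ψ (x, v)) fun v => hb _
  simp only [hset] at ha hab
  have h := mem_relCore_of_sections (convex_dom hψ hb) (intrinsicInterior_subset_relCore _ ha)
    (intrinsicInterior_subset_relCore _ hab)
  let A : Vec n × Vec n →ₗ[ℝ] Vec n × Vec n := LinearMap.prod (LinearMap.fst ℝ _ _)
    (LinearMap.snd ℝ _ _ + LinearMap.fst ℝ _ _)
  have hA : ∀ q, A q = (q.1, q.2 + q.1) := fun _ => rfl
  have himage : A '' dom ψ = dom fun q : Vec n × Vec n => ψ (q.1, q.2 - q.1) := by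
    ext q
    constructor
    · rintro ⟨z, hz, rfl⟩
      change ψ ((A z).1, (A z).2 - (A z).1) < ⊤
      rw [hA, add_sub_cancel_right]
      exact hz
    · intro hq
      exact ⟨_, hq, by rw [hA, sub_add_cancel]⟩
  have h' := relCore_image h A
  rwa [himage, hA, sub_add_cancel] at h'

/-- The primal running cost as a function of the endpoints of a step. -/
def primalStep (L : ℕ → Vec n × Vec n → EReal) (t : ℕ) (q : Vec n × Vec n) : EReal :=
  L t (q.1, q.2 - q.1)

/-- The dual running cost as a function of the endpoints of a step. -/
noncomputable def dualStep (L : ℕ → Vec n × Vec n → EReal) (t : ℕ) (q : Vec n × Vec n) : EReal :=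
  dualLagrangian L t (q.2, q.2 - q.1)

theorem convex_epi_primalStep (hL : Convex ℝ (epi (L t))) : Convex ℝ (epi (primalStep L t)) :=
  convex_epi_comp hL (LinearMap.prod (LinearMap.fst ℝ (Vec n) (Vec n))
    (LinearMap.snd ℝ (Vec n) (Vec n) - LinearMap.fst ℝ (Vec n) (Vec n)))

theorem convex_epi_dualStep : Convex ℝ (epi (dualStep L t)) :=
  convex_epi_comp (convex_epi_dualLagrangian L t)
    (LinearMap.prod (LinearMap.snd ℝ (Vec n) (Vec n))
      (LinearMap.snd ℝ (Vec n) (Vec n) - LinearMap.fst ℝ (Vec n) (Vec n)))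

theorem PrimalStrictlyFeasible.exists_path
    (hL : ∀ t ∈ Finset.Icc 1 T, IsProperConvexLsc (L t)) (h : PrimalStrictlyFeasible L g T) :
    ∃ x : ℕ → Vec n, x T ∈ relCore (dom g) ∧
      ∀ t ∈ Finset.Icc 1 T, (x (t - 1), x t) ∈ relCore (dom (primalStep L t)) := by
  obtain ⟨x, hxT, hx⟩ := h
  exact ⟨x, intrinsicInterior_subset_relCore _ hxT, fun t ht =>
    mem_relCore_dom_step (hL t ht).convex (hL t ht).proper.2 (hx t ht).1 (hx t ht).2⟩

theorem DualStrictlyFeasible.exists_path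
    (hL : ∀ t ∈ Finset.Icc 1 T, IsProperConvexLsc (L t)) (h : DualStrictlyFeasible L g T) :
    ∃ p : ℕ → Vec n, p T ∈ relCore (dom (dualTerminal g)) ∧
      ∀ t ∈ Finset.Icc 1 T, (p (t - 1), p t) ∈ relCore (dom (dualStep L t)) := by
  obtain ⟨p, hpT, hp⟩ := h
  refine ⟨p, intrinsicInterior_subset_relCore _ hpT, fun t ht => ?_⟩
  -- The dual cost evaluates $K_t$ at the new state $p_t=p_{t-1}+w$, which is why $\Gamma_K$
  -- involves $K_t(p+w,w)$.
  have hstep : dualStep L t = fun q : Vec n × Vec n =>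
      (fun z : Vec n × Vec n => dualLagrangian L t (z.1 + z.2, z.2)) (q.1, q.2 - q.1) := by
    funext q
    simp [dualStep]
  rw [hstep]
  exact mem_relCore_dom_step
    (convex_epi_comp (convex_epi_dualLagrangian L t)
      (LinearMap.prod (LinearMap.fst ℝ (Vec n) (Vec n) + LinearMap.snd ℝ (Vec n) (Vec n))
        (LinearMap.snd ℝ (Vec n) (Vec n))))
    (fun z => bot_lt_dualLagrangian (hL t ht).proper.1 _) (hp t ht).1 (hp t ht).2

theorem bot_lt_primalCost (hL : ∀ t ∈ Finset.Ioc τ T, IsProper (L t)) (hg : IsProper g)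
    (x : ℕ → Vec n) : ⊥ < primalCost L g T τ x :=
  bot_lt_chainCost (M := primalStep L) (fun t ht _ => (hL t ht).2 _) hg.2 x

theorem bot_lt_dualCost (hL : ∀ t ∈ Finset.Ioc τ T, IsProper (L t)) (hg : IsProper g)
    (p : ℕ → Vec n) : ⊥ < dualCost L g T τ p :=
  bot_lt_chainCost (M := dualStep L) (fun t ht _ => bot_lt_dualLagrangian (hL t ht).1 _)
    (bot_lt_dualTerminal hg.1) p

/-! ### Conjugacy and attainment for the value functions. -/

theorem primalValue_le (x : ℕ → Vec n) : primalValue L g T τ (x τ) ≤ primalCost L g T τ x :=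
  iInf_le (fun x' : {x' : ℕ → Vec n // x' τ = x τ} => primalCost L g T τ x'.1) ⟨x, rfl⟩

theorem dualValue_le (p : ℕ → Vec n) : dualValue L g T τ (-p τ) ≤ dualCost L g T τ p :=
  iInf_le (fun p' : {p' : ℕ → Vec n // p' τ = - -p τ} => dualCost L g T τ p'.1)
    ⟨p, (neg_neg _).symm⟩

theorem conj_dualValue_le (hτ : τ ≤ T) (hL : ∀ t ∈ Finset.Ioc τ T, IsProper (L t))
    (hg : IsProper g) (ξ : Vec n) : conj (dualValue L g T τ) ξ ≤ primalValue L g T τ ξ := by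
  refine iSup_le fun η => le_iInf fun ⟨x, hx⟩ =>
    coe_sub_iInf_le (bot_lt_primalCost hL hg x) fun ⟨p, hp⟩ => ?_
  have := neg_inner_le_primalCost_add_dualCost hτ hL hg x p
  rwa [hx, hp, inner_neg_right, neg_neg, real_inner_comm] at this

theorem conj_primalValue_le (hτ : τ ≤ T) (hL : ∀ t ∈ Finset.Ioc τ T, IsProper (L t))
    (hg : IsProper g) (η : Vec n) : conj (primalValue L g T τ) η ≤ dualValue L g T τ η := by
  refine iSup_le fun ξ => le_iInf fun ⟨p, hp⟩ =>
    coe_sub_iInf_le (bot_lt_dualCost hL hg p) fun ⟨x, hx⟩ => ?_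
  have := neg_inner_le_primalCost_add_dualCost hτ hL hg x p
  rwa [hx, hp, inner_neg_right, neg_neg, add_comm] at this

theorem exists_primalCost_le_conj_dualValue (hτ : τ ≤ T)
    (hL : ∀ t ∈ Finset.Ioc τ T, IsProperConvexLsc (L t)) (hg : IsProperConvexLsc g)
    {p : ℕ → Vec n} (hpT : p T ∈ relCore (dom (dualTerminal g)))
    (hp : ∀ t ∈ Finset.Ioc τ T, (p (t - 1), p t) ∈ relCore (dom (dualStep L t)))
    {ξ : Vec n} (hξ : conj (dualValue L g T τ) ξ < ⊤) :
    ∃ x : ℕ → Vec n, x τ = ξ ∧ primalCost L g T τ x ≤ conj (dualValue L g T τ) ξ := by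
  have hLp := fun t ht => (hL t ht).proper
  have hKb : ∀ t ∈ Finset.Ioc τ T, ∀ q, ⊥ < dualStep L t q :=
    fun t ht q => bot_lt_dualLagrangian (hLp t ht).1 _
  have hpfin : dualCost L g T τ p < ⊤ :=
    (mem_relCore_dom_chainCost (M := dualStep L) (fun t _ => convex_epi_dualStep) hKb
      (convex_epi_dualTerminal g) (bot_lt_dualTerminal hg.proper.1) hp hpT).1
  obtain ⟨α, hα⟩ := exists_real_eq
    (bot_lt_conj ⟨-p τ, (dualValue_le p).trans_lt hpfin⟩ ξ) hξ
  obtain ⟨y, hyτ, hy⟩ := exists_dual_path hτ (fun t _ => convex_epi_dualStep) hKb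
    (convex_epi_dualTerminal g) (bot_lt_dualTerminal hg.proper.1) hp hpT
    (innerₗ (Vec n) (-ξ)) α (by
      intro q
      refine coe_le_add_of_coe_sub_le (bot_lt_dualCost hLp hg.proper q) (EReal.bot_lt_coe α) ?_
      rw [← hα]
      refine le_trans ?_ (inner_sub_le_conj _ (-q τ) ξ)
      refine EReal.sub_le_sub (le_of_eq ?_) (dualValue_le q)
      rw [innerₗ_apply_apply, inner_neg_left, inner_neg_left, real_inner_comm])
  -- The multipliers start at $-\xi$, hence the sign that makes `x τ` equal to `ξ`.
  choose x hx using fun t => exists_inner_eq (-y t)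
  have hyx : ∀ t a, y t a = -inner ℝ (x t) a := fun t a => by rw [← hx]; simp
  refine ⟨x, ?_, ?_⟩
  · refine ext_inner_right ℝ fun a => ?_
    rw [← hx, hyτ]
    simp
  · rw [hα]
    refine le_trans (add_le_add (Finset.sum_le_sum fun t ht => ?_) ?_) hy
    · refine le_of_forall_real_lt_le fun r hr => ?_
      -- The conjugate of the dual step cost dominates $L_t$ by biconjugation; the endpoints `(p -
      -- w, p)` have new state `p` and increment `w`.
      obtain ⟨p, w, hpw⟩ := exists_lt_inner_sub_dualLagrangian (hL t ht) hr
      refine hpw.trans (le_trans (le_of_eq ?_) (le_iSup (fun q : Vec n × Vec n =>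
        ((y (t - 1) q.1 - y t q.2 : ℝ) : EReal) - dualStep L t q) (p - w, p)))
      simp only [dualStep, hyx, sub_sub_cancel]
      congr 2
      rw [inner_sub_left, inner_sub_right]
      ring
    · refine le_of_forall_real_lt_le fun r hr => ?_
      obtain ⟨b, hb⟩ := exists_lt_inner_sub_dualTerminal hg hr
      refine hb.trans (le_trans (le_of_eq ?_) (le_iSup (fun a : Vec n =>
        ((y T a : ℝ) : EReal) - dualTerminal g a) b))
      simp only [hyx, inner_neg_right]

theorem exists_dualCost_le_conj_primalValue (hτ : τ ≤ T)
    (hL : ∀ t ∈ Finset.Ioc τ T, IsProperConvexLsc (L t)) (hg : IsProperConvexLsc g)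
    {x : ℕ → Vec n} (hxT : x T ∈ relCore (dom g))
    (hx : ∀ t ∈ Finset.Ioc τ T, (x (t - 1), x t) ∈ relCore (dom (primalStep L t)))
    {η : Vec n} (hη : conj (primalValue L g T τ) η < ⊤) :
    ∃ p : ℕ → Vec n, p τ = -η ∧ dualCost L g T τ p ≤ conj (primalValue L g T τ) η := by
  have hLp := fun t ht => (hL t ht).proper
  have hLc := fun t ht => convex_epi_primalStep (hL t ht).convex
  have hLb : ∀ t ∈ Finset.Ioc τ T, ∀ q, ⊥ < primalStep L t q := fun t ht q => (hLp t ht).2 _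
  have hxfin : primalCost L g T τ x < ⊤ :=
    (mem_relCore_dom_chainCost (M := primalStep L) hLc hLb hg.convex hg.proper.2 hx hxT).1
  obtain ⟨α, hα⟩ := exists_real_eq
    (bot_lt_conj ⟨x τ, (primalValue_le x).trans_lt hxfin⟩ η) hη
  obtain ⟨y, hyτ, hy⟩ := exists_dual_path hτ hLc hLb hg.convex hg.proper.2 hx hxT
    (innerₗ (Vec n) η) α (by
      intro z
      refine coe_le_add_of_coe_sub_le (bot_lt_primalCost hLp hg.proper z) (EReal.bot_lt_coe α) ?_
      rw [← hα]
      refine le_trans ?_ (inner_sub_le_conj _ (z τ) η)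
      refine EReal.sub_le_sub (le_of_eq ?_) (primalValue_le z)
      rw [innerₗ_apply_apply, real_inner_comm])
  choose p hp using fun t => exists_inner_eq (-y t)
  have hyp : ∀ t a, y t a = -inner ℝ (p t) a := fun t a => by rw [← hp]; simp
  refine ⟨p, ?_, ?_⟩
  · refine ext_inner_right ℝ fun a => ?_
    rw [← hp, hyτ]
    simp
  · rw [hα]
    refine le_trans (add_le_add (Finset.sum_le_sum fun t ht => ?_) ?_) hy
    -- Each term of the supremum defining $K_t$ is a term of the conjugate of the step cost, taken
    -- at the endpoints of the step with state `z.1` and velocity `z.2`.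
    · refine iSup_le fun z => le_trans (le_of_eq ?_) (le_iSup (fun q : Vec n × Vec n =>
        ((y (t - 1) q.1 - y t q.2 : ℝ) : EReal) - primalStep L t q) (z.1, z.1 + z.2))
      simp only [primalStep, hyp, add_sub_cancel_left]
      congr 2
      rw [inner_sub_right, inner_add_right, real_inner_comm z.1 (p t),
        real_inner_comm z.1 (p (t - 1)), real_inner_comm z.2 (p t)]
      ring
    · refine iSup_le fun a => le_trans (le_of_eq ?_) (le_iSup (fun a : Vec n =>
        ((y T a : ℝ) : EReal) - g a) a)
      rw [hyp, inner_neg_right, real_inner_comm]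

end ConvexBolza

/-! ### The main theorem. -/

theorem mainTheorem3 {n : ℕ} (T : ℕ)
    (L : ℕ → ConvexBolza.Vec n × ConvexBolza.Vec n → EReal) (g : ConvexBolza.Vec n → EReal)
    (hL : ∀ t ∈ Finset.Icc 1 T, ConvexBolza.IsProperConvexLsc (L t))
    (hg : ConvexBolza.IsProperConvexLsc g)
    (hdual : ConvexBolza.DualStrictlyFeasible L g T) :
    (∀ τ ≤ T,
      ConvexBolza.conj (ConvexBolza.dualValue L g T τ) = ConvexBolza.primalValue L g T τ ∧
      ∀ ξ ∈ ConvexBolza.dom (ConvexBolza.primalValue L g T τ),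
        ∃ x : ℕ → ConvexBolza.Vec n, x τ = ξ ∧
          ConvexBolza.primalCost L g T τ x = ConvexBolza.primalValue L g T τ ξ) ∧
    (ConvexBolza.PrimalStrictlyFeasible L g T →
      ∀ τ ≤ T,
        ConvexBolza.IsProperConvexLsc (ConvexBolza.primalValue L g T τ) ∧
        ConvexBolza.IsProperConvexLsc (ConvexBolza.dualValue L g T τ) ∧
        ConvexBolza.conj (ConvexBolza.primalValue L g T τ) = ConvexBolza.dualValue L g T τ ∧
        ConvexBolza.conj (ConvexBolza.dualValue L g T τ) = ConvexBolza.primalValue L g T τ) := by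
  open ConvexBolza in
  have hsub : ∀ {τ t : ℕ}, t ∈ Finset.Ioc τ T → t ∈ Finset.Icc 1 T := by
    intro τ t ht
    rw [Finset.mem_Ioc] at ht
    rw [Finset.mem_Icc]
    omega
  have hLs : ∀ τ, ∀ t ∈ Finset.Ioc τ T, IsProperConvexLsc (L t) := fun τ t ht => hL t (hsub ht)
  have hLp : ∀ τ, ∀ t ∈ Finset.Ioc τ T, IsProper (L t) := fun τ t ht => (hLs τ t ht).proper
  obtain ⟨p, hpT, hp⟩ := hdual.exists_path hL
  have hstrong : ∀ τ ≤ T, ∀ ξ, conj (dualValue L g T τ) ξ < ⊤ →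
      ∃ x : ℕ → Vec n, x τ = ξ ∧ primalCost L g T τ x ≤ conj (dualValue L g T τ) ξ :=
    fun τ hτ ξ hξ => exists_primalCost_le_conj_dualValue hτ (hLs τ) hg hpT
      (fun t ht => hp t (hsub ht)) hξ
  have hconj : ∀ τ ≤ T, conj (dualValue L g T τ) = primalValue L g T τ := by
    intro τ hτ
    funext ξ
    refine le_antisymm (conj_dualValue_le hτ (hLp τ) hg.proper ξ) ?_
    by_cases h : conj (dualValue L g T τ) ξ < ⊤
    · obtain ⟨x, rfl, hx⟩ := hstrong τ hτ ξ h
      exact (primalValue_le x).trans hx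
    · rw [not_lt_top_iff.1 h]
      exact le_top
  refine ⟨fun τ hτ => ⟨hconj τ hτ, fun ξ hξ => ?_⟩, fun hprimal τ hτ => ?_⟩
  · obtain ⟨x, rfl, hx⟩ := hstrong τ hτ ξ (by rw [hconj τ hτ]; exact hξ)
    rw [hconj τ hτ] at hx
    exact ⟨x, rfl, le_antisymm hx (primalValue_le x)⟩
  obtain ⟨x, hxT, hx⟩ := hprimal.exists_path hL
  have hconj' : conj (primalValue L g T τ) = dualValue L g T τ := by
    funext η
    refine le_antisymm (conj_primalValue_le hτ (hLp τ) hg.proper η) ?_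
    by_cases h : conj (primalValue L g T τ) η < ⊤
    · obtain ⟨q, hq, hqη⟩ := exists_dualCost_le_conj_primalValue hτ (hLs τ) hg hxT
        (fun t ht => hx t (hsub ht)) h
      have := dualValue_le (L := L) (g := g) (T := T) (τ := τ) q
      rw [hq, neg_neg] at this
      exact this.trans hqη
    · rw [not_lt_top_iff.1 h]
      exact le_top
  have hxfin : x τ ∈ dom (primalValue L g T τ) := (primalValue_le x).trans_lt
    ((chainCost_lt_top_iff (M := primalStep L) (fun t ht _ => (hLp τ t ht).2 _) hg.proper.2 x).2
      ⟨fun t ht => (hx t (hsub ht)).1, hxT.1⟩)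
  have hpfin : -p τ ∈ dom (dualValue L g T τ) := (dualValue_le p).trans_lt
    ((chainCost_lt_top_iff (M := dualStep L)
      (fun t ht _ => bot_lt_dualLagrangian (hLp τ t ht).1 _)
      (bot_lt_dualTerminal hg.proper.1) p).2 ⟨fun t ht => (hp t (hsub ht)).1, hpT.1⟩)
  -- Strictly feasible paths make both domains nonempty. The rest follows by writing each value
  -- function as the conjugate of the other.
  refine ⟨⟨⟨⟨_, hxfin⟩, ?_⟩, ?_, ?_⟩, ⟨⟨⟨_, hpfin⟩, ?_⟩, ?_, ?_⟩, hconj', hconj τ hτ⟩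
  · rw [← hconj τ hτ]
    exact bot_lt_conj ⟨_, hpfin⟩
  · rw [← hconj τ hτ]
    exact convex_epi_conj _
  · rw [← hconj τ hτ]
    exact lowerSemicontinuous_conj _
  · rw [← hconj']
    exact bot_lt_conj ⟨_, hxfin⟩
  · rw [← hconj']
    exact convex_epi_conj _
  · rw [← hconj']
    exact lowerSemicontinuous_conj _
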